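/- Let $X$ be a real Banach space with continuous dual $X^*$. For a set-valued operator $A\colon X\rightrightarrows X^*$, let $\operatorname{gra}A=\{(x,x^*)\in X\times X^* : x^*\in Ax\}$ and $\operatorname{dom}A=\{x\in X : Ax\neq\varnothing\}$. The operator $A$ is monotone if $\langle x-y,x^*-y^*\rangle\ge 0$ for all $(x,x^*),(y,y^*)\in\operatorname{gra}A$, and maximal monotone if it is monotone and has no proper monotone extension (in the sense of graph inclusion). A maximal monotone operator $A$ is of type (FPV) if, for every open convex set $U\subseteq X$ with $U\cap\operatorname{dom}A\neq\varnothing$ and every $(x,x^*)\in U\times X^*$ such that $\langle x-y,x^*-y^*\rangle\ge 0$ for all $(y,y^*)\in\operatorname{gra}A\cap(U\times X^*)$, one has $(x,x^*)\in\operatorname{gra}A$. Let $A\colon X\rightrightarrows X^*$ be maximal monotone of type (FPV), and let $B\colon X\rightrightarrows X^*$ be maximal monotone with full domain, i.e. $\operatorname{dom}B=X$. Then the sum operator $A+B\colon x\mapsto Ax+Bx=\{a^*+b^* : a^*\in Ax,\ b^*\in Bx\}$ is maximal monotone. -/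

import Mathlib

namespace MonotoneOperatorTheory

/-- A set-valued operator from the real normed space `X` to its continuous dual. -/
abbrev SetValuedOperator (X : Type*) [NormedAddCommGroup X] [NormedSpace ℝ X] : Type _ :=
  X → Set (StrongDual ℝ X)

namespace SetValuedOperator

variable {X : Type*} [NormedAddCommGroup X] [NormedSpace ℝ X]

/-- The graph of `A`: the pairs `(x, x')` with `x' ∈ A x`. -/
def graph (A : SetValuedOperator X) : Set (X × StrongDual ℝ X) :=
  {p | p.2 ∈ A p.1}

/-- The domain of `A`: the points `x` with `A x` nonempty. -/
def dom (A : SetValuedOperator X) : Set X :=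
  {x | (A x).Nonempty}

/-- The sum operator: `x ↦ A x + B x = {a + b | a ∈ A x, b ∈ B x}`. -/
def sum (A B : SetValuedOperator X) : SetValuedOperator X :=
  fun x => {c | ∃ a ∈ A x, ∃ b ∈ B x, c = a + b}

/-- `A` is monotone: `⟨x - y, x' - y'⟩ ≥ 0` for all `(x, x')`, `(y, y')` in its graph. -/
def IsMonotone (A : SetValuedOperator X) : Prop :=
  ∀ p ∈ graph A, ∀ q ∈ graph A, 0 ≤ (p.2 - q.2) (p.1 - q.1)

/-- `A` is maximal monotone: it is monotone and has no proper monotone extension, in the sense of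
graph inclusion. -/
def IsMaximalMonotone (A : SetValuedOperator X) : Prop :=
  IsMonotone A ∧
    ∀ B : SetValuedOperator X, IsMonotone B → graph A ⊆ graph B → graph B = graph A

/-- The pair `p = (x, x')` is monotonically related to the set `G` of pairs:
`⟨x - y, x' - y'⟩ ≥ 0` for all `(y, y') ∈ G`. -/
def MonotonicallyRelated (p : X × StrongDual ℝ X) (G : Set (X × StrongDual ℝ X)) : Prop :=
  ∀ q ∈ G, 0 ≤ (p.2 - q.2) (p.1 - q.1)

/-- The condition of type (FPV) for a (maximal monotone) operator `A`: for every open convex set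
`U` that meets the domain of `A`, each pair `(x, x')` with `x ∈ U` that is monotonically related to
the part of the graph of `A` lying over `U` belongs to the graph of `A`. -/
def IsTypeFPV (A : SetValuedOperator X) : Prop :=
  ∀ U : Set X, IsOpen U → Convex ℝ U → (U ∩ dom A).Nonempty →
    ∀ (x : X) (x' : StrongDual ℝ X), x ∈ U →
      MonotonicallyRelated (x, x') (graph A ∩ U ×ˢ (Set.univ : Set (StrongDual ℝ X))) →
      (x, x') ∈ graph A

end SetValuedOperator

end MonotoneOperatorTheory

/-!
Let `(z, z')` be monotonically related to the graph of `A + B`; translate it to the origin. Write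
`F_T(x, u) = sup {⟨x, y'⟩ + ⟨y, u⟩ - ⟨y, y'⟩ | (y, y') ∈ graph T}` for the Fitzpatrick function of `T`.

The type (FPV) condition is used only to show `F_{A+B} ≥ ⟨·, ·⟩` (`exists_sum_lt`), which is trivial
over `dom A`. For `x ∉ dom A` one uses that `B`, having full domain, is locally bounded by Baire's
theorem (`IsMonotone.locally_bounded`), hence bounded on a neighbourhood of a segment from `x` to a
point of `dom A`.

Since `F_{A+B} (0, 0) ≤ 0` and the pairing is quadratic, convexity then gives `F_{A+B} ≥ 0`
everywhere, so `F_A(x, u) + F_B(x, v) ≥ F_{A+B}(x, u + v) ≥ 0`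
(`marginalEpigraph_add_nonneg`). The marginal of `F_B` in `x` is finite everywhere and bounded above
near the origin, so Hahn–Banach separation in `X × ℝ` (`exists_splitting`) yields `w` with
`F_A(0, w) + F_B(0, -w) ≤ 0`. Both terms are nonnegative by maximality, so both vanish, which means
`w ∈ A 0` and `-w ∈ B 0`.
-/

namespace MonotoneOperatorTheory

namespace SetValuedOperator

open Set Metric Topology

variable {X : Type*} [NormedAddCommGroup X] [NormedSpace ℝ X]

/-! ### Maximality and monotonically related pairs -/

theorem IsMonotone.sum {A B : SetValuedOperator X} (hA : A.IsMonotone) (hB : B.IsMonotone) :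
    (A.sum B).IsMonotone := by
  rintro ⟨x, _⟩ ⟨a, ha, b, hb, rfl⟩ ⟨y, _⟩ ⟨c, hc, d, hd, rfl⟩
  have h₁ := hA (x, a) ha (y, c) hc
  have h₂ := hB (x, b) hb (y, d) hd
  simp only [sub_apply, add_apply] at *
  linarith

theorem IsMaximalMonotone.mem_graph {A : SetValuedOperator X} (hA : A.IsMaximalMonotone)
    {p : X × StrongDual ℝ X} (hp : MonotonicallyRelated p (graph A)) : p ∈ graph A := by
  let C : SetValuedOperator X := fun x => {x' | (x, x') ∈ insert p (graph A)}
  have hC : graph C = insert p (graph A) := rfl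
  have hmono : C.IsMonotone := by
    unfold IsMonotone
    rw [hC]
    rintro q (rfl | hq) r (rfl | hr)
    · simp
    · exact hp r hr
    · have := hp q hq
      simp only [sub_apply, map_sub] at *
      linarith
    · exact hA.1 q hq r hr
  rw [← hA.2 C hmono (hC ▸ subset_insert _ _), hC]
  exact mem_insert _ _

theorem isMaximalMonotone_of_mem_graph {A : SetValuedOperator X} (hA : A.IsMonotone)
    (h : ∀ p, MonotonicallyRelated p (graph A) → p ∈ graph A) : A.IsMaximalMonotone :=
  ⟨hA, fun _ hC hAC => (Subset.antisymm hAC fun p hp =>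
    h p fun q hq => hC p hp q (hAC hq)).symm⟩

/-- The Fitzpatrick function of a maximal monotone operator dominates the duality pairing: the
infimum of `⟨a - x, a' - x'⟩` over the graph is nonpositive. -/
theorem IsMaximalMonotone.exists_lt {A : SetValuedOperator X} (hA : A.IsMaximalMonotone)
    (x : X) (x' : StrongDual ℝ X) {ε : ℝ} (hε : 0 < ε) :
    ∃ p ∈ graph A, (p.2 - x') (p.1 - x) < ε := by
  by_contra! h
  have hx : (x, x') ∈ graph A := hA.mem_graph fun q hq => by
    have := h q hq
    simp only [sub_apply, map_sub] at *
    linarith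
  have := h _ hx
  simp at this
  linarith

theorem IsMaximalMonotone.dom_nonempty {A : SetValuedOperator X} (hA : A.IsMaximalMonotone) :
    A.dom.Nonempty :=
  let ⟨p, hp, _⟩ := hA.exists_lt 0 0 one_pos
  ⟨p.1, p.2, hp⟩

theorem nonempty_of_dom_eq_univ {B : SetValuedOperator X} (hdom : B.dom = univ) (x : X) :
    (B x).Nonempty := by
  have hx : x ∈ B.dom := hdom ▸ mem_univ x
  exact hx

/-! ### Local boundedness of monotone operators with full domain -/

/-- The sublevel sets of `x ↦ sup {⟨x - y, y'⟩ | (y, y') ∈ graph B, ‖y - x₀‖ ≤ 1}` are closed,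
convex and cover `X` because `B` is monotone with full domain. By Baire one of them has an interior
point, and convexity moves this ball to `x₀`. -/
theorem IsMonotone.exists_ball_sub_le [CompleteSpace X] {B : SetValuedOperator X}
    (hB : B.IsMonotone) (hdom : B.dom = univ) (x₀ : X) :
    ∃ r > 0, ∃ M : ℝ, ∀ x ∈ ball x₀ r, ∀ p ∈ graph B, ‖p.1 - x₀‖ ≤ 1 → p.2 (x - p.1) ≤ M := by
  let S : ℕ → Set X := fun n => {x | ∀ p ∈ graph B, ‖p.1 - x₀‖ ≤ 1 → p.2 (x - p.1) ≤ n}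
  have hS : ∀ x, ∃ n, x ∈ S n := by
    intro x
    obtain ⟨x', hx'⟩ := nonempty_of_dom_eq_univ hdom x
    obtain ⟨n, hn⟩ := exists_nat_ge (‖x'‖ * (‖x - x₀‖ + 1))
    refine ⟨n, fun p hp hp1 => ?_⟩
    have h₁ := hB (x, x') hx' p hp
    have h₂ : x' (x - p.1) ≤ ‖x'‖ * ‖x - p.1‖ := x'.le_of_opNorm_le le_rfl _ |> (le_abs_self _).trans
    have h₃ : ‖x - p.1‖ ≤ ‖x - x₀‖ + 1 := by
      have := norm_sub_le (x - x₀) (p.1 - x₀)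
      rw [sub_sub_sub_cancel_right] at this
      linarith
    have h₄ := mul_le_mul_of_nonneg_left h₃ (norm_nonneg x')
    simp only [sub_apply] at h₁
    linarith
  have hclosed : ∀ n, IsClosed (S n) := by
    intro n
    simp only [S, ofPred_forall]
    refine isClosed_iInter fun p => isClosed_iInter fun _ => isClosed_iInter fun _ => ?_
    exact isClosed_le (by fun_prop) continuous_const
  obtain ⟨n, q, hq⟩ := nonempty_interior_of_iUnion_of_closed hclosed
    (eq_univ_of_forall fun x => mem_iUnion.2 (hS x))
  obtain ⟨r, hr, hball⟩ := Metric.mem_nhds_iff.1 (mem_interior_iff_mem_nhds.1 hq)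
  -- `x₀` is the midpoint of `q` and its reflection `2 x₀ - q`.
  obtain ⟨m, hm⟩ := hS ((2 : ℝ) • x₀ - q)
  refine ⟨r / 2, by positivity, (n + m) / 2, fun x hx p hp hp1 => ?_⟩
  have hy : (2 : ℝ) • x - ((2 : ℝ) • x₀ - q) ∈ ball q r := by
    rw [mem_ball_iff_norm] at hx ⊢
    have : (2 : ℝ) • x - ((2 : ℝ) • x₀ - q) - q = (2 : ℝ) • (x - x₀) := by
      rw [smul_sub]; abel
    rw [this, norm_smul, Real.norm_of_nonneg zero_le_two]
    linarith
  have h₁ := hball hy p hp hp1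
  have h₂ := hm p hp hp1
  simp only [map_sub, map_smul, smul_eq_mul] at *
  linarith

theorem IsMonotone.locally_bounded [CompleteSpace X] {B : SetValuedOperator X}
    (hB : B.IsMonotone) (hdom : B.dom = univ) (x₀ : X) :
    ∃ r > 0, ∃ M : ℝ, ∀ y ∈ ball x₀ r, ∀ y' ∈ B y, ‖y'‖ ≤ M := by
  obtain ⟨r, hr, M, hM⟩ := hB.exists_ball_sub_le hdom x₀
  refine ⟨min (r / 4) 1, by positivity, 4 * |M| / r, fun y hy y' hy' => ?_⟩
  rw [mem_ball_iff_norm, lt_min_iff] at hy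
  -- `y'` is bounded by `M` on the ball of radius `r / 2` around `y`.
  refine y'.opNorm_le_of_shell (ε := r / 2) (by positivity) (by positivity)
    (c := (2 : ℝ)) (by norm_num) fun v hv₁ hv₂ => ?_
  rw [Real.norm_of_nonneg zero_le_two] at hv₁
  have key : ∀ w : X, ‖w‖ < r / 2 → y' w ≤ |M| := fun w hw => by
    have hmem : y + w ∈ ball x₀ r := by
      rw [mem_ball_iff_norm, add_sub_right_comm]
      have := norm_add_le (y - x₀) w
      linarith
    have := hM _ hmem (y, y') hy' hy.2.le
    simp only [add_sub_cancel_left] at this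
    exact this.trans (le_abs_self M)
  have h₁ := key v hv₂
  have h₂ := key (-v) (by rwa [norm_neg])
  rw [map_neg] at h₂
  have h₃ : |M| = 4 * |M| / r * (r / 2 / 2) := by field_simp; norm_num
  calc ‖y' v‖ ≤ |M| := abs_le.2 ⟨by linarith, h₁⟩
    _ = 4 * |M| / r * (r / 2 / 2) := h₃
    _ ≤ 4 * |M| / r * ‖v‖ := by gcongr

theorem IsMonotone.bounded_thickening [CompleteSpace X] {B : SetValuedOperator X}
    (hB : B.IsMonotone) (hdom : B.dom = univ) {K : Set X} (hK : IsCompact K) :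
    ∃ r > 0, ∃ M : ℝ, ∀ y ∈ thickening r K, ∀ y' ∈ B y, ‖y'‖ ≤ M := by
  suffices h : ∃ V, IsOpen V ∧ K ⊆ V ∧ ∃ M : ℝ, ∀ y ∈ V, ∀ y' ∈ B y, ‖y'‖ ≤ M by
    obtain ⟨V, hV, hKV, M, hM⟩ := h
    obtain ⟨r, hr, hrV⟩ := hK.exists_thickening_subset_open hV hKV
    exact ⟨r, hr, M, fun y hy => hM y (hrV hy)⟩
  refine hK.induction_on
    (p := fun K => ∃ V, IsOpen V ∧ K ⊆ V ∧ ∃ M : ℝ, ∀ y ∈ V, ∀ y' ∈ B y, ‖y'‖ ≤ M)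
    ⟨∅, isOpen_empty, le_rfl, 0, by simp⟩ ?_ ?_ ?_
  · rintro s t hst ⟨V, hV, htV, hM⟩
    exact ⟨V, hV, hst.trans htV, hM⟩
  · rintro s t ⟨V, hV, hsV, M, hM⟩ ⟨W, hW, htW, N, hN⟩
    refine ⟨V ∪ W, hV.union hW, union_subset_union hsV htW, max M N, ?_⟩
    rintro y (hy | hy) y' hy'
    · exact (hM y hy y' hy').trans (le_max_left _ _)
    · exact (hN y hy y' hy').trans (le_max_right _ _)
  · intro x hx
    obtain ⟨r, hr, M, hM⟩ := hB.locally_bounded hdom x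
    exact ⟨ball x r, mem_nhdsWithin_of_mem_nhds (ball_mem_nhds x hr), ball x r, isOpen_ball,
      le_rfl, M, hM⟩

/-! ### The Fitzpatrick function of the sum dominates the duality pairing -/

/-- If `x ∉ dom A`, join `x` to a point `a₀` of `dom A`, and apply the (FPV) condition on a thin
neighbourhood of the segment, on which `B` is bounded, to the pair `(x, w)` with `w` steep
in the direction `a₀ - x`: this yields a point of the graph of `A` where `w` outweighs `B`. -/
theorem exists_sum_lt [CompleteSpace X] {A B : SetValuedOperator X}
    (hA : A.IsMaximalMonotone) (hA_fpv : A.IsTypeFPV) (hB : B.IsMonotone) (hdom : B.dom = univ)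
    (x : X) (x' : StrongDual ℝ X) {ε : ℝ} (hε : 0 < ε) :
    ∃ y, ∃ a ∈ A y, ∃ b ∈ B y, (a + b - x') (y - x) < ε := by
  have hBne := nonempty_of_dom_eq_univ hdom
  by_cases hx : x ∈ A.dom
  · obtain ⟨a, ha⟩ := hx
    obtain ⟨b, hb⟩ := hBne x
    exact ⟨x, a, ha, b, hb, by simpa using hε⟩
  obtain ⟨a₀, ha₀⟩ := hA.dom_nonempty
  have hne : a₀ - x ≠ 0 := fun h => hx (sub_eq_zero.1 h ▸ ha₀)
  have hcpt : IsCompact (segment ℝ x a₀) := by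
    rw [← convexHull_pair]
    exact (toFinite _).isCompact_convexHull ℝ
  obtain ⟨r, hr, M, hM⟩ := hB.bounded_thickening hdom hcpt
  obtain ⟨g, hg, hga⟩ := exists_dual_vector ℝ (a₀ - x) (norm_ne_zero_iff.2 hne)
  have hga' : g (a₀ - x) = ‖a₀ - x‖ := hga
  -- `L` bounds `b - x'` for all `b ∈ B y` with `y` near the segment.
  set L : ℝ := |M| + ‖x'‖
  have hL0 : 0 ≤ L := by positivity
  obtain ⟨δ, hδ, hδr, hδε⟩ : ∃ δ > 0, δ ≤ r ∧ 2 * L * δ < ε := by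
    refine ⟨min r (ε / (2 * L + 1)), by positivity, min_le_left _ _, ?_⟩
    calc 2 * L * min r (ε / (2 * L + 1)) ≤ 2 * L * (ε / (2 * L + 1)) := by
          gcongr; exact min_le_right _ _
      _ < (2 * L + 1) * (ε / (2 * L + 1)) := by
          gcongr; linarith
      _ = ε := by field_simp
  set U := thickening δ (segment ℝ x a₀)
  have hU : IsOpen U := isOpen_thickening
  have hUc : Convex ℝ U := (convex_segment x a₀).thickening δ
  have hxU : x ∈ U := self_subset_thickening hδ _ (left_mem_segment ℝ x a₀)
  have haU : a₀ ∈ U := self_subset_thickening hδ _ (right_mem_segment ℝ x a₀)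
  have hnot : ¬ MonotonicallyRelated (x, -(L • g)) (graph A ∩ U ×ˢ univ) := fun h =>
    hx ⟨_, hA_fpv U hU hUc ⟨a₀, haU, ha₀⟩ x _ hxU h⟩
  simp only [MonotonicallyRelated, not_forall, not_le] at hnot
  obtain ⟨⟨y, a⟩, ⟨hya, hyU, -⟩, hlt⟩ := hnot
  obtain ⟨b, hb⟩ := hBne y
  refine ⟨y, a, hya, b, hb, ?_⟩
  obtain ⟨c, hc, hyc⟩ := mem_thickening_iff.1 hyU
  rw [segment_eq_image'] at hc
  obtain ⟨t, ht, rfl⟩ := hc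
  have hbL : ‖b - x'‖ ≤ L := by
    have := hM y (thickening_mono hδr _ hyU) b hb
    exact (norm_sub_le _ _).trans (add_le_add (this.trans (le_abs_self M)) le_rfl)
  set e := y - (x + t • (a₀ - x)) with he
  rw [dist_eq_norm] at hyc
  have hye : y - x = t • (a₀ - x) + e := by rw [he]; abel
  have hge : -‖e‖ ≤ g e := by
    have := g.le_opNorm e
    rw [hg, one_mul] at this
    exact (abs_le.1 this).1
  have h₁ : (b - x') (y - x) ≤ L * (t * ‖a₀ - x‖ + ‖e‖) := by
    refine (le_abs_self _).trans (((b - x').le_opNorm _).trans ?_)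
    have : ‖y - x‖ ≤ t * ‖a₀ - x‖ + ‖e‖ := by
      rw [hye]
      refine (norm_add_le _ _).trans ?_
      rw [norm_smul, Real.norm_of_nonneg ht.1]
    gcongr
  have h₂ : L * (t * ‖a₀ - x‖ - ‖e‖) ≤ L * g (y - x) := by
    rw [hye, map_add, map_smul, hga', smul_eq_mul]
    gcongr
    linarith
  have h₃ : L * ‖e‖ ≤ L * δ := by gcongr
  have h₄ : a (y - x) < -(L * g (y - x)) := by
    simp only [sub_apply, neg_apply,
      smul_apply, smul_eq_mul, map_sub] at *
    linarith
  have h₅ : (a + b - x') (y - x) = a (y - x) + (b - x') (y - x) := by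
    simp only [sub_apply, add_apply]
    ring
  rw [h₅]
  nlinarith

/-! ### Fenchel duality for Fitzpatrick functions -/

/-- The epigraph of the marginal Fitzpatrick function `x ↦ inf_u F_G(x, u)` of a set `G`
of pairs, where `F_G(x, u) = sup {⟨x, a'⟩ + ⟨a, u⟩ - ⟨a, a'⟩ | (a, a') ∈ G}`. It is encoded as the set
of `(x, r)` with `F_G(x, u) ≤ r` for some `u`, so as to avoid extended real values. -/
def marginalEpigraph (G : Set (X × StrongDual ℝ X)) : Set (X × ℝ) :=
  {q | ∃ u : StrongDual ℝ X, ∀ p ∈ G, p.2 q.1 + u p.1 - p.2 p.1 ≤ q.2}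

theorem convex_marginalEpigraph (G : Set (X × StrongDual ℝ X)) :
    Convex ℝ (marginalEpigraph G) := by
  rintro ⟨x, r⟩ ⟨u, hu⟩ ⟨y, s⟩ ⟨v, hv⟩ a b ha hb hab
  refine ⟨a • u + b • v, fun p hp => ?_⟩
  have h₁ := mul_le_mul_of_nonneg_left (hu p hp) ha
  have h₂ := mul_le_mul_of_nonneg_left (hv p hp) hb
  have h₃ : p.2 p.1 = a * p.2 p.1 + b * p.2 p.1 := by rw [← add_mul, hab, one_mul]
  simp only [Prod.fst_add, Prod.snd_add, Prod.smul_fst, Prod.smul_snd, map_add, map_smul,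
    smul_eq_mul, add_apply, smul_apply] at *
  linarith

theorem mem_marginalEpigraph {G : Set (X × StrongDual ℝ X)}
    (hG : ∀ p ∈ G, ∀ q ∈ G, 0 ≤ (p.2 - q.2) (p.1 - q.1)) {p : X × StrongDual ℝ X} (hp : p ∈ G)
    {r : ℝ} (hr : p.2 p.1 ≤ r) : (p.1, r) ∈ marginalEpigraph G := by
  refine ⟨p.2, fun q hq => ?_⟩
  have := hG p hp q hq
  simp only [sub_apply, map_sub] at *
  linarith

/-- If `(0, 0)` is monotonically related to the sum of `G` and `H`, whose Fitzpatrick function `F`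
dominates the pairing, then `F ≥ 0`: the convex function `F` has a minimum at the origin because
`t² ⟨x, u⟩ ≤ F (t x, t u) ≤ t F (x, u)` for `0 < t ≤ 1`. Since `F` is at most the sum of the
Fitzpatrick functions of `G` and `H` (in the second variable), so is this sum. -/
theorem marginalEpigraph_add_nonneg {G H : Set (X × StrongDual ℝ X)}
    (h₀ : ∀ x a b, (x, a) ∈ G → (x, b) ∈ H → 0 ≤ (a + b) x)
    (h₁ : ∀ (x : X) (u : StrongDual ℝ X) (ε : ℝ), 0 < ε →
      ∃ y a b, (y, a) ∈ G ∧ (y, b) ∈ H ∧ (a + b - u) (y - x) < ε)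
    {x : X} {r s : ℝ} (hr : (x, r) ∈ marginalEpigraph G) (hs : (x, s) ∈ marginalEpigraph H) :
    0 ≤ r + s := by
  obtain ⟨u, hu⟩ := hr
  obtain ⟨v, hv⟩ := hs
  have key : ∀ t : ℝ, 0 < t → t ≤ 1 → t * (u + v) x ≤ r + s + t := by
    intro t ht ht1
    obtain ⟨y, a, b, ha, hb, hlt⟩ := h₁ (t • x) (t • (u + v)) (t * t) (by positivity)
    have h₂ := mul_le_mul_of_nonneg_left (add_le_add (hu _ ha) (hv _ hb)) ht.le
    have h₃ := mul_nonneg (sub_nonneg.2 ht1) (h₀ y a b ha hb)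
    refine le_of_mul_le_mul_left ?_ ht
    simp only [sub_apply, add_apply, map_sub, map_smul,
      smul_apply, smul_eq_mul] at *
    linarith
  by_contra! hneg
  set c := (u + v) x
  obtain ⟨t, ht, ht1, htc⟩ : ∃ t : ℝ, 0 < t ∧ t ≤ 1 ∧ t * (1 + |c|) < -(r + s) := by
    have hc : 0 < 1 + |c| := by positivity
    have h2 : 0 < -(r + s) / (2 * (1 + |c|)) := div_pos (by linarith) (by positivity)
    refine ⟨min 1 (-(r + s) / (2 * (1 + |c|))), lt_min one_pos h2, min_le_left _ _, ?_⟩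
    calc min 1 (-(r + s) / (2 * (1 + |c|))) * (1 + |c|)
        ≤ -(r + s) / (2 * (1 + |c|)) * (1 + |c|) := by gcongr; exact min_le_right _ _
      _ = -(r + s) / 2 := by field_simp
      _ < -(r + s) := by linarith
  have h₂ := key t ht ht1
  have h₃ := mul_le_mul_of_nonneg_left (neg_abs_le c) ht.le
  linarith

/-- Fenchel duality for two monotone sets of pairs, the second one with full domain and bounded near
the origin: separating the epigraph of one marginal Fitzpatrick function from the reflected epigraph
of the other gives a functional that splits the inequality. -/
theorem exists_splitting {G H : Set (X × StrongDual ℝ X)} (hGne : G.Nonempty)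
    (hG : ∀ p ∈ G, ∀ q ∈ G, 0 ≤ (p.2 - q.2) (p.1 - q.1))
    (hH : ∀ p ∈ H, ∀ q ∈ H, 0 ≤ (p.2 - q.2) (p.1 - q.1))
    (hHdom : ∀ x, ∃ b, (x, b) ∈ H)
    {ρ M : ℝ} (hρ : 0 < ρ) (hHbdd : ∀ p ∈ H, ‖p.1‖ < ρ → ‖p.2‖ ≤ M)
    (hGH : ∀ x r s, (x, r) ∈ marginalEpigraph G → (x, s) ∈ marginalEpigraph H → 0 ≤ r + s) :
    ∃ w : StrongDual ℝ X, ∀ p ∈ G, ∀ q ∈ H, 0 ≤ (p.2 - w) p.1 + (q.2 + w) q.1 := by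
  let R : X × ℝ →L[ℝ] X × ℝ :=
    (ContinuousLinearMap.fst ℝ X ℝ).prod (-(ContinuousLinearMap.snd ℝ X ℝ))
  let D : Set (X × ℝ) := R ⁻¹' marginalEpigraph H
  have hD : Convex ℝ D := (convex_marginalEpigraph H).linear_preimage R.toLinearMap
  have hmemD : ∀ x r, (x, r) ∈ D ↔ (x, -r) ∈ marginalEpigraph H := fun _ _ => Iff.rfl
  have hint : ((0 : X), -(|M| * ρ + 1)) ∈ interior D := by
    rw [mem_interior]
    refine ⟨ball 0 ρ ×ˢ Iio (-(|M| * ρ)), ?_, isOpen_ball.prod isOpen_Iio,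
      mem_ball_self hρ, by simp⟩
    rintro ⟨x, r⟩ ⟨hx, hr⟩
    rw [mem_ball_zero_iff] at hx
    obtain ⟨b, hb⟩ := hHdom x
    have hbM := (hHbdd _ hb hx).trans (le_abs_self M)
    refine (hmemD x r).2 (mem_marginalEpigraph hH hb ?_)
    have h₁ : b x ≤ |M| * ρ :=
      (le_abs_self _).trans ((b.le_opNorm x).trans (by gcongr))
    simp only [mem_Iio] at hr
    change b x ≤ -r
    linarith
  have hdisj : Disjoint (interior D) (marginalEpigraph G) := by
    rw [Set.disjoint_left]
    rintro ⟨x, r⟩ hxD hxG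
    -- An interior point of `D` can be raised a little within `D`.
    have hlim : Filter.Tendsto (fun η : ℝ => (x, r + η)) (𝓝[>] 0) (𝓝 (x, r)) := by
      have : Continuous fun η : ℝ => (x, r + η) := by fun_prop
      have h := this.tendsto 0
      rw [add_zero] at h
      exact h.mono_left nhdsWithin_le_nhds
    obtain ⟨η, hηD, hη⟩ := ((hlim.eventually (mem_interior_iff_mem_nhds.1 hxD)).and
      self_mem_nhdsWithin).exists
    have := hGH x r _ hxG ((hmemD _ _).1 hηD)
    have hη' : 0 < η := hη
    linarith
  obtain ⟨f, s, hfD, hfG⟩ := geometric_hahn_banach_open hD.interior isOpen_interior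
    (convex_marginalEpigraph G) hdisj
  have hfD' : ∀ q ∈ D, f q ≤ s := by
    have hsub : closure (interior D) ⊆ {q | f q ≤ s} :=
      closure_minimal (fun q hq => (hfD q hq).le) (isClosed_le f.continuous continuous_const)
    rw [hD.closure_interior_eq_closure_of_nonempty_interior ⟨_, hint⟩] at hsub
    exact fun q hq => hsub (subset_closure hq)
  set φ : StrongDual ℝ X := f.comp (ContinuousLinearMap.inl ℝ X ℝ)
  set τ : ℝ := f (0, 1)
  have hf : ∀ x r, f (x, r) = φ x + r * τ := by
    intro x r
    have : (x, r) = (x, (0 : ℝ)) + r • ((0 : X), (1 : ℝ)) := by simp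
    rw [this, map_add, map_smul]
    rfl
  have hGmem : ∀ p ∈ G, s ≤ φ p.1 + p.2 p.1 * τ := fun p hp => by
    rw [← hf]
    exact hfG _ (mem_marginalEpigraph hG hp le_rfl)
  have hHmem : ∀ q ∈ H, φ q.1 - q.2 q.1 * τ ≤ s := fun q hq => by
    have := hfD' (q.1, -(q.2 q.1))
      ((hmemD _ _).2 (by rw [neg_neg]; exact mem_marginalEpigraph hH hq le_rfl))
    rw [hf] at this
    linarith
  obtain ⟨p₀, hp₀⟩ := hGne
  have hτ0 : 0 ≤ τ := by
    by_contra! hneg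
    -- Raise a point of the epigraph high enough to violate the lower bound `s`.
    set k : ℝ := max 0 ((φ p₀.1 + p₀.2 p₀.1 * τ - s + 1) / -τ)
    have hk := hfG (p₀.1, p₀.2 p₀.1 + k)
      (mem_marginalEpigraph hG hp₀ (le_add_of_nonneg_right (le_max_left _ _)))
    have hk' : (φ p₀.1 + p₀.2 p₀.1 * τ - s + 1) / -τ ≤ k := le_max_right _ _
    rw [div_le_iff₀ (by linarith)] at hk'
    rw [hf] at hk
    linarith
  have hτpos : 0 < τ := by
    refine hτ0.lt_of_ne fun h => ?_
    -- A vertical hyperplane is impossible: `φ ≤ s` on all of `X` forces `φ = 0`.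
    rw [← h] at hGmem hHmem
    have hle : ∀ x, φ x ≤ s := fun x => by
      obtain ⟨b, hb⟩ := hHdom x
      simpa using hHmem _ hb
    have hφ0 : ∀ x, φ x ≤ 0 := by
      intro x
      by_contra! hx
      have := hle (((s + 1) / φ x) • x)
      rw [map_smul, smul_eq_mul, div_mul_cancel₀ _ hx.ne'] at this
      linarith
    have h₁ := hfD _ hint
    rw [hf, ← h] at h₁
    have h₂ := hGmem _ hp₀
    have h₃ := hφ0 p₀.1
    simp at h₁ h₂
    linarith
  refine ⟨-(τ⁻¹ • φ), fun p hp q hq => ?_⟩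
  have h₁ := hGmem p hp
  have h₂ := hHmem q hq
  have h₃ : 0 ≤ τ⁻¹ * ((φ p.1 + p.2 p.1 * τ) - (φ q.1 - q.2 q.1 * τ)) :=
    mul_nonneg (inv_nonneg.2 hτ0) (by linarith)
  have h₄ : τ⁻¹ * ((φ p.1 + p.2 p.1 * τ) - (φ q.1 - q.2 q.1 * τ)) =
      (p.2 p.1 + τ⁻¹ * φ p.1) + (q.2 q.1 - τ⁻¹ * φ q.1) := by
    field_simp
    ring
  rw [h₄] at h₃
  simpa [sub_eq_add_neg] using h₃

end SetValuedOperator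

end MonotoneOperatorTheory

open MonotoneOperatorTheory SetValuedOperator in
theorem corollary3p6 {X : Type*} [NormedAddCommGroup X] [NormedSpace ℝ X] [CompleteSpace X]
    (A B : MonotoneOperatorTheory.SetValuedOperator X)
    (hA : A.IsMaximalMonotone) (hA_fpv : A.IsTypeFPV)
    (hB : B.IsMaximalMonotone) (hB_dom : B.dom = Set.univ) :
    (A.sum B).IsMaximalMonotone := by
  refine isMaximalMonotone_of_mem_graph (hA.1.sum hB.1) ?_
  rintro ⟨z, z'⟩ hz
  -- Translate so that the pair `(z, z')` becomes the origin.
  let G : Set (X × StrongDual ℝ X) := {p | p.2 ∈ A (p.1 + z)}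
  let H : Set (X × StrongDual ℝ X) := {p | p.2 + z' ∈ B (p.1 + z)}
  have hG : ∀ p ∈ G, ∀ q ∈ G, 0 ≤ (p.2 - q.2) (p.1 - q.1) := fun p hp q hq => by
    simpa using hA.1 (p.1 + z, p.2) hp (q.1 + z, q.2) hq
  have hH : ∀ p ∈ H, ∀ q ∈ H, 0 ≤ (p.2 - q.2) (p.1 - q.1) := fun p hp q hq => by
    simpa using hB.1 (p.1 + z, p.2 + z') hp (q.1 + z, q.2 + z') hq
  have hGne : G.Nonempty := by
    obtain ⟨a, a', ha⟩ := hA.dom_nonempty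
    exact ⟨(a - z, a'), by simpa [G] using ha⟩
  have hHdom : ∀ x, ∃ b, (x, b) ∈ H := fun x => by
    obtain ⟨b, hb⟩ := nonempty_of_dom_eq_univ hB_dom (x + z)
    exact ⟨b - z', by simpa [H] using hb⟩
  obtain ⟨ρ, hρ, M, hM⟩ := hB.1.locally_bounded hB_dom z
  have hHbdd : ∀ p ∈ H, ‖p.1‖ < ρ → ‖p.2‖ ≤ M + ‖z'‖ := fun p hp hpρ => by
    have h₁ := hM (p.1 + z) (by simpa [mem_ball_iff_norm] using hpρ) _ hp
    have h₂ := norm_sub_le (p.2 + z') z'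
    rw [add_sub_cancel_right] at h₂
    linarith
  have h₀ : ∀ x a b, (x, a) ∈ G → (x, b) ∈ H → 0 ≤ (a + b) x := fun x a b ha hb => by
    have := hz (x + z, a + (b + z')) ⟨a, ha, b + z', hb, rfl⟩
    simp only [sub_apply, add_apply, map_sub,
      map_add] at *
    linarith
  have h₁ : ∀ (x : X) (u : StrongDual ℝ X) (ε : ℝ), 0 < ε →
      ∃ y a b, (y, a) ∈ G ∧ (y, b) ∈ H ∧ (a + b - u) (y - x) < ε := fun x u ε hε => by
    obtain ⟨y, a, ha, b, hb, hlt⟩ := exists_sum_lt hA hA_fpv hB.1 hB_dom (x + z) (u + z') hε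
    refine ⟨y - z, a, b - z', by simpa [G] using ha, by simpa [H] using hb, ?_⟩
    have e₁ : a + (b - z') - u = a + b - (u + z') := by abel
    have e₂ : y - z - x = y - (x + z) := by abel
    rwa [e₁, e₂]
  obtain ⟨w, hw⟩ := exists_splitting hGne hG hH hHdom hρ hHbdd
    fun x r s hr hs => marginalEpigraph_add_nonneg h₀ h₁ hr hs
  have hw' : ∀ p ∈ graph A, ∀ q ∈ graph B,
      0 ≤ (p.2 - w) (p.1 - z) + (q.2 - (z' - w)) (q.1 - z) := fun p hp q hq => by
    have := hw (p.1 - z, p.2) (by simpa [G] using show p.2 ∈ A p.1 from hp)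
      (q.1 - z, q.2 - z') (by simpa [H] using show q.2 ∈ B q.1 from hq)
    rwa [sub_add] at this
  -- Both infima over the graphs are nonpositive by maximality and their sum is nonnegative.
  have hAw : w ∈ A z := hA.mem_graph (p := (z, w)) fun p hp =>
    le_of_forall_pos_le_add fun ε hε => by
      obtain ⟨q, hq, hlt⟩ := hB.exists_lt z (z' - w) hε
      have := hw' p hp q hq
      simp only [sub_apply, map_sub] at *
      linarith
  have hBw : z' - w ∈ B z := hB.mem_graph (p := (z, z' - w)) fun q hq =>
    le_of_forall_pos_le_add fun ε hε => by
      obtain ⟨p, hp, hlt⟩ := hA.exists_lt z w hε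
      have := hw' p hp q hq
      simp only [sub_apply, map_sub] at *
      linarith
  exact ⟨w, hAw, z' - w, hBw, (add_sub_cancel _ _).symm⟩
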